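/- For $m\ge 0$ let $\mathfrak S_m(312)$ be the set of permutations $\pi=\pi_1\cdots\pi_m$ of $\{1,\dots,m\}$ that avoid the pattern $312$, i.e. for which there are no indices $i<j<k$ with $\pi_j<\pi_k<\pi_i$. The standardization of a word $x_1\cdots x_m$ with distinct letters is the permutation of $\{1,\dots,m\}$ whose letters appear in the same relative order as those of the word. Let $G(n,312)$ be the directed multigraph with vertex set $\mathfrak S_n(312)$ and edge set $\mathfrak S_{n+1}(312)$, where $\sigma=\sigma_1\cdots\sigma_{n+1}$ is an edge from (tail) the standardization of $\sigma_1\cdots\sigma_n$ to (head) the standardization of $\sigma_2\cdots\sigma_{n+1}$. A closed walk of length $d$ is a list of edges $(e_1,\dots,e_d)$ such that the head of $e_i$ is the tail of $e_{i+1}$ for $1\le i\le d-1$ and the head of $e_d$ is the tail of $e_1$. Two closed walks of length $d$ are equivalent if they are cyclic shifts of each other, and a $d$-cycle is an equivalence class of closed walks of length $d$ that has exactly $d$ elements. **Theorem.** For all integers $1\le d\le n$, the number of $d$-cycles in $G(n,312)$ is $$\frac1d\sum_{e\mid d}\mu\!\left(\frac de\right)\binom{2e}{e},$$ where the sum is over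 the positive divisors $e$ of $d$ and $\mu$ is the number-theoretic Möbius function. -/

import Mathlib

open Equiv

namespace OverlapGraph

/-! ### Standardization and pattern avoidance

Permutations of `{1, …, n}` are represented by `Perm (Fin n)`, i.e. with letters and positions
shifted down by one. -/

/-- The number of letters of the word `x` that are smaller than its `i`-th letter. -/
def rank {α : Type*} [LinearOrder α] {n : ℕ} (x : Fin n → α) (i : Fin n) : Fin n :=
  ⟨(Finset.univ.filter fun j => x j < x i).card, by
    have h : (Finset.univ.filter fun j => x j < x i) ⊂ (Finset.univ : Finset (Fin n)) := by
      refine Finset.filter_ssubset.2 ⟨i, Finset.mem_univ i, lt_irrefl _⟩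
    simpa using Finset.card_lt_card h⟩

theorem rank_lt_rank_iff {α : Type*} [LinearOrder α] {n : ℕ} (x : Fin n → α) (i j : Fin n) :
    rank x i < rank x j ↔ x i < x j := by
  constructor
  · intro h
    by_contra hle
    refine absurd h (not_lt.2 (Fin.mk_le_mk.2 (Finset.card_le_card ?_)))
    intro k hk
    simp only [Finset.mem_filter, Finset.mem_univ, true_and] at hk ⊢
    exact lt_of_lt_of_le hk (not_lt.1 hle)
  · intro h
    refine Fin.mk_lt_mk.2 (Finset.card_lt_card ?_)
    refine (Finset.ssubset_iff_of_subset ?_).2 ⟨i, by simpa using h, by simp⟩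
    intro k hk
    simp only [Finset.mem_filter, Finset.mem_univ, true_and] at hk ⊢
    exact hk.trans h

theorem rank_injective {α : Type*} [LinearOrder α] {n : ℕ} {x : Fin n → α}
    (hx : Function.Injective x) : Function.Injective (rank x) := by
  intro i j hij
  rcases lt_trichotomy (x i) (x j) with h | h | h
  · exact absurd hij ((rank_lt_rank_iff x i j).2 h).ne
  · exact hx h
  · exact absurd hij ((rank_lt_rank_iff x j i).2 h).ne'

/-- The standardization of a word with distinct letters: the permutation whose letters have the
same relative order as those of the word. -/
noncomputable def standardization {α : Type*} [LinearOrder α] {n : ℕ} (x : Fin n → α)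
    (hx : Function.Injective x) : Perm (Fin n) :=
  Equiv.ofBijective (rank x) (Finite.injective_iff_bijective.1 (rank_injective hx))

theorem standardization_val {α : Type*} [LinearOrder α] {n : ℕ} (x : Fin n → α)
    (hx : Function.Injective x) (i : Fin n) :
    (standardization x hx i : ℕ) = (Finset.univ.filter fun j => x j < x i).card :=
  rfl

theorem standardization_lt_iff {α : Type*} [LinearOrder α] {n : ℕ} (x : Fin n → α)
    (hx : Function.Injective x) (i j : Fin n) :
    standardization x hx i < standardization x hx j ↔ x i < x j :=
  rank_lt_rank_iff x i j

/-- The word `π_{i_1} π_{i_2} ⋯ π_{i_k}` has distinct letters. -/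
theorem injective_subword {n k : ℕ} (π : Perm (Fin n)) (i : Fin k ↪o Fin n) :
    Function.Injective fun a => π (i a) :=
  π.injective.comp i.injective

/-- `π` avoids `τ`: no subword `π_{i_1} ⋯ π_{i_k}` with `i_1 < ⋯ < i_k` has standardization
`τ`. -/
def Avoids {n k : ℕ} (π : Perm (Fin n)) (τ : Perm (Fin k)) : Prop :=
  ¬ ∃ i : Fin k ↪o Fin n,
    standardization (fun a => π (i a)) (injective_subword π i) = τ

/-- The standardization of a factor of a `τ`-avoiding permutation is `τ`-avoiding. -/
theorem Avoids.standardization_subword {n m k : ℕ} {σ : Perm (Fin m)} {τ : Perm (Fin k)}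
    (h : Avoids σ τ) (s : Fin n ↪o Fin m) :
    Avoids (standardization (fun a => σ (s a)) (injective_subword σ s)) τ := by
  rintro ⟨i, hi⟩
  refine h ⟨i.trans s, ?_⟩
  rw [← hi]
  ext a
  rw [standardization_val, standardization_val]
  simp only [standardization_lt_iff]
  rfl

/-- The pattern `312` (as a map on `{0, 1, 2}`: `0 ↦ 2`, `1 ↦ 0`, `2 ↦ 1`). -/
def pattern312 : Perm (Fin 3) where
  toFun := ![2, 0, 1]
  invFun := ![1, 2, 0]
  left_inv := by decide
  right_inv := by decide

/-! ### Directed multigraphs, closed walks and cycles -/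

/-- A directed multigraph with vertices `V` and edges `E` (loops and parallel edges allowed);
the edge `e` goes from `tail e` to `head e`. -/
structure Multidigraph (V E : Type*) where
  tail : E → V
  head : E → V

namespace Multidigraph

variable {V E : Type*} (G : Multidigraph V E)

/-- Closed walks of length `d`: lists of `d` edges in which the head of each edge is the tail of
the cyclically next one (`finRotate d` sends `i` to `i + 1` modulo `d`). -/
def ClosedWalk (d : ℕ) : Type _ :=
  {e : Fin d → E // ∀ i, G.head (e i) = G.tail (e (finRotate d i))}

/-- Two closed walks of length `d` are equivalent if they are cyclic shifts of each other. -/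
def shiftSetoid (d : ℕ) : Setoid (G.ClosedWalk d) where
  r w w' := ∃ k : ℕ, ∀ i, w'.1 i = w.1 ((finRotate d ^ k) i)
  iseqv :=
    { refl := fun w => ⟨0, fun i => by simp⟩
      symm := by
        rintro w w' ⟨k, hk⟩
        obtain ⟨m, hm⟩ : ∃ m : ℕ, finRotate d ^ k * finRotate d ^ m = 1 := by
          refine ⟨k * (orderOf (finRotate d) - 1), ?_⟩
          have hpos : 0 < orderOf (finRotate d) := orderOf_pos _
          rw [← pow_add, show k + k * (orderOf (finRotate d) - 1) = orderOf (finRotate d) * k by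
            obtain ⟨r, hr⟩ := Nat.exists_eq_succ_of_ne_zero hpos.ne'
            rw [hr, Nat.succ_sub_one, Nat.succ_eq_add_one]; ring, pow_mul, pow_orderOf_eq_one,
            one_pow]
        refine ⟨m, fun i => ?_⟩
        rw [hk, ← Perm.mul_apply, hm, Perm.one_apply]
      trans := by
        rintro u v w ⟨k, hk⟩ ⟨m, hm⟩
        refine ⟨k + m, fun i => ?_⟩
        rw [hm, hk, pow_add, Perm.mul_apply] }

/-- The `d`-cycles: the cyclic-shift classes of closed walks of length `d` that have exactly `d`
elements. -/
def cycles (d : ℕ) : Set (Set (G.ClosedWalk d)) :=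
  {C | C ∈ (G.shiftSetoid d).classes ∧ C.ncard = d}

end Multidigraph

/-! ### Graphs of overlapping permutations -/

/-- The graph `G(n)` of overlapping permutations: each `σ ∈ S_{n+1}` is an edge from the
standardization of `σ_1 ⋯ σ_n` to the standardization of `σ_2 ⋯ σ_{n+1}`. -/
noncomputable def overlapGraph (n : ℕ) : Multidigraph (Perm (Fin n)) (Perm (Fin (n + 1))) where
  tail σ := standardization (fun i => σ (Fin.castSuccOrderEmb i)) (injective_subword σ _)
  head σ := standardization (fun i => σ (Fin.succOrderEmb n i)) (injective_subword σ _)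

/-- The graph `G(n, τ)` of overlapping `τ`-avoiding permutations: the subgraph of `G(n)` with
the `τ`-avoiding permutations in `S_n` as vertices and those in `S_{n+1}` as edges. -/
noncomputable def avoidingOverlapGraph (n : ℕ) {k : ℕ} (τ : Perm (Fin k)) :
    Multidigraph {π : Perm (Fin n) // Avoids π τ} {σ : Perm (Fin (n + 1)) // Avoids σ τ} where
  tail σ := ⟨(overlapGraph n).tail σ.1, σ.2.standardization_subword _⟩
  head σ := ⟨(overlapGraph n).head σ.1, σ.2.standardization_subword _⟩

end OverlapGraph

/-! Unrolled closed walks of length $d$ are the points of period $d$ of the shift, and $d$-cycles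
correspond to orbits of size exactly $d$. Möbius inversion (`ncard_cycles_eq`) thus reduces the
claim to counting closed walks: there are $\binom{2d}{d}$ of them when $1\le d\le n$
(`card_closedWalk`).

In a 312-avoiding edge the letters exceeding the last one form a block directly before it; let `a i`
be its length in the `i`-th edge. The overlaps carry each comparison of two letters back to an edge
in which the later one is last, so `a` determines the walk (`IsCyclicFamily.eq_of_lastBlock_eq`).
Transitivity makes the arcs `[i - a i, i]` with `a i < n` laminar; `a i = n` only says that the
block fills the window. Conversely, a laminar family prescribes consistent linear orders
(`exists_isCyclicFamily`).

As with matching brackets, a laminar family is recovered from the number of bounded arcs opening at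
each of the $d$ points, and every choice of counts with sum at most $d$ occurs (`laminarEquiv`).
Stars and bars finishes the count. -/

namespace OverlapGraph
-- Cycles as shift orbits, and Möbius inversion
namespace Multidigraph

variable {V E : Type*} (G : Multidigraph V E)

/-- One-sided infinite walks. -/
def Walk : Type _ := {x : ℕ → E // ∀ i, G.head (x i) = G.tail (x (i + 1))}

/-- The walk without its first edge. -/
def shift (x : G.Walk) : G.Walk := ⟨fun i => x.1 (i + 1), fun i => x.2 (i + 1)⟩

theorem shift_iterate (k : ℕ) (x : G.Walk) (i : ℕ) : (G.shift^[k] x).1 i = x.1 (i + k) := by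
  induction k generalizing x i with
  | zero => rfl
  | succ k ih => rw [Function.iterate_succ_apply, ih]; exact congrArg x.1 (by omega)

theorem apply_mod_of_isPeriodicPt {d : ℕ} {x : G.Walk} (hx : Function.IsPeriodicPt G.shift d x)
    (i : ℕ) : x.1 (i % d) = x.1 i := by
  have h : ∀ q r, x.1 (r + d * q) = x.1 r := by
    intro q r
    have := congrArg (fun y : G.Walk => y.1 r) (hx.mul_const q)
    simpa only [shift_iterate] using this
  conv_rhs => rw [← Nat.mod_add_div i d]
  rw [h]

theorem finRotate_pow_ofNat (d k j : ℕ) :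
    (finRotate (d + 1) ^ k) (Fin.ofNat (d + 1) j) = Fin.ofNat (d + 1) (j + k) := by
  induction k with
  | zero => rfl
  | succ k ih =>
    rw [pow_succ', Perm.mul_apply, ih, finRotate_apply]
    ext
    simp [Fin.val_add, add_assoc]

theorem finRotate_ofNat (d j : ℕ) :
    finRotate (d + 1) (Fin.ofNat (d + 1) j) = Fin.ofNat (d + 1) (j + 1) := by
  simpa using finRotate_pow_ofNat d 1 j

/-- Closed walks of length `d + 1` unroll to the infinite walks of period `d + 1`. -/
def closedWalkEquiv (d : ℕ) :
    G.ClosedWalk (d + 1) ≃ {x : G.Walk // Function.IsPeriodicPt G.shift (d + 1) x} where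
  toFun w := ⟨⟨fun j => w.1 (Fin.ofNat (d + 1) j), fun j => by
      rw [w.2, finRotate_ofNat]⟩, by
    refine Subtype.ext (funext fun j => ?_)
    exact (G.shift_iterate _ _ _).trans (congrArg w.1 (Fin.ext (by simp)))⟩
  invFun x := ⟨fun i => x.1.1 i, fun i => by
    rw [x.1.2 i]
    have h : ((finRotate (d + 1) i : Fin (d + 1)) : ℕ) = (i + 1) % (d + 1) := by
      conv_lhs => rw [← Fin.ofNat_val_eq_self i, finRotate_ofNat]
      rfl
    simp only [h, apply_mod_of_isPeriodicPt G x.2]⟩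
  left_inv w := by
    refine Subtype.ext (funext fun i => ?_)
    exact congrArg w.1 (Fin.ext (Nat.mod_eq_of_lt i.2))
  right_inv x := by
    refine Subtype.ext (Subtype.ext (funext fun j => ?_))
    exact apply_mod_of_isPeriodicPt G x.2 j

theorem shiftSetoid_iff {d : ℕ} (w w' : G.ClosedWalk (d + 1)) :
    (G.shiftSetoid (d + 1)).r w w' ↔
      ∃ k, (G.closedWalkEquiv d w').1 = G.shift^[k] (G.closedWalkEquiv d w).1 := by
  refine exists_congr fun k => ⟨fun h => ?_, fun h i => ?_⟩
  · refine Subtype.ext (funext fun j => ?_)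
    rw [shift_iterate]
    change w'.1 _ = w.1 _
    rw [h, finRotate_pow_ofNat]
  · have := congrArg (fun y : G.Walk => y.1 i) h
    simp only [shift_iterate] at this
    change w'.1 (Fin.ofNat (d + 1) i) = w.1 (Fin.ofNat (d + 1) (i + k)) at this
    rw [← finRotate_pow_ofNat] at this
    simpa only [Fin.ofNat_val_eq_self] using this

/-- The size of a cyclic-shift class is the minimal period of its members. -/
theorem ncard_shift_class {d : ℕ} (w : G.ClosedWalk (d + 1)) :
    {w' | (G.shiftSetoid (d + 1)).r w' w}.ncard =
      Function.minimalPeriod G.shift (G.closedWalkEquiv d w).1 := by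
  set x := (G.closedWalkEquiv d w).1 with hx
  have hper : Function.IsPeriodicPt G.shift (d + 1) x := (G.closedWalkEquiv d w).2
  have hpos := hper.minimalPeriod_pos d.succ_pos
  have himg : (fun w' => (G.closedWalkEquiv d w').1) '' {w' | (G.shiftSetoid (d + 1)).r w' w} =
      (fun k => G.shift^[k] x) '' Set.Iio (Function.minimalPeriod G.shift x) := by
    ext y
    constructor
    · rintro ⟨w', hw', rfl⟩
      obtain ⟨k, hk⟩ := (G.shiftSetoid_iff _ _).1 ((G.shiftSetoid (d + 1)).symm hw')
      exact ⟨_, Nat.mod_lt k hpos, (Function.iterate_mod_minimalPeriod_eq).trans hk.symm⟩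
    · rintro ⟨k, _, rfl⟩
      refine ⟨(G.closedWalkEquiv d).symm ⟨_, hper.apply_iterate k⟩, ?_, by simp⟩
      refine (G.shiftSetoid (d + 1)).symm ((G.shiftSetoid_iff _ _).2 ⟨k, ?_⟩)
      simp [hx]
  rw [← Set.ncard_image_of_injective _
    (Subtype.val_injective.comp (G.closedWalkEquiv d).injective)]
  refine (congrArg Set.ncard himg).trans ?_
  rw [Set.InjOn.ncard_image Function.iterate_injOn_Iio_minimalPeriod, ← Finset.coe_Iio,
    Set.ncard_coe_finset, Nat.card_Iio]

instance [Finite E] (d : ℕ) : Finite (G.ClosedWalk d) :=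
  inferInstanceAs (Finite {_e : Fin d → E // _})

theorem finite_isPeriodicPt [Finite E] {d : ℕ} (hd : 0 < d) :
    {x | Function.IsPeriodicPt G.shift d x}.Finite := by
  obtain ⟨d, rfl⟩ := Nat.exists_eq_succ_of_ne_zero hd.ne'
  exact Finite.of_equiv _ (G.closedWalkEquiv d)

/-- The walks of minimal period `d` are partitioned into the `d`-cycles, each of size `d`. -/
theorem mul_ncard_cycles [Finite E] {d : ℕ} (hd : 0 < d) :
    d * (G.cycles d).ncard = {x | x ∈ Function.periodicPts G.shift ∧
      Function.minimalPeriod G.shift x = d}.ncard := by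
  classical
  obtain ⟨d, rfl⟩ := Nat.exists_eq_succ_of_ne_zero hd.ne'
  simp only [Nat.succ_eq_add_one]
  have : Fintype (G.ClosedWalk (d + 1)) := Fintype.ofFinite _
  set cls : G.ClosedWalk (d + 1) → Set (G.ClosedWalk (d + 1)) :=
    fun w => {w' | (G.shiftSetoid (d + 1)).r w' w} with hcls
  set P : Finset (G.ClosedWalk (d + 1)) := Finset.univ.filter fun w =>
    Function.minimalPeriod G.shift (G.closedWalkEquiv d w).1 = d + 1 with hP
  have hmemP : ∀ w, w ∈ P ↔ (cls w).ncard = d + 1 := by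
    intro w; simp [hP, hcls, ncard_shift_class]
  have hcyc : G.cycles (d + 1) = ↑(P.image cls) := by
    ext C
    simp only [cycles, Set.mem_ofPred_eq, Finset.coe_image, Set.mem_image, Finset.mem_coe, hmemP]
    constructor
    · rintro ⟨⟨w, rfl⟩, h⟩
      exact ⟨w, h, rfl⟩
    · rintro ⟨w, h, rfl⟩
      exact ⟨⟨w, rfl⟩, h⟩
  have hfib : ∀ C ∈ P.image cls, (P.filter fun w => cls w = C).card = d + 1 := by
    intro C hC
    obtain ⟨w, hw, rfl⟩ := Finset.mem_image.1 hC
    refine Eq.trans ?_ ((hmemP w).1 hw)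
    rw [← Set.ncard_coe_finset]
    congr 1
    ext w'
    simp only [Finset.coe_filter, Set.mem_ofPred_eq, hmemP]
    constructor
    · rintro ⟨_, h⟩
      rw [← h]
      exact (G.shiftSetoid (d + 1)).refl w'
    · intro h
      have h' : cls w' = cls w := by
        ext v
        exact ⟨fun hv => (G.shiftSetoid (d + 1)).trans hv h,
          fun hv => (G.shiftSetoid (d + 1)).trans hv ((G.shiftSetoid (d + 1)).symm h)⟩
      exact ⟨h' ▸ (hmemP w).1 hw, h'⟩
  have hcard : P.card = (d + 1) * (P.image cls).card := by
    rw [Finset.card_eq_sum_card_fiberwise (fun w hw => Finset.mem_image_of_mem cls hw),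
      Finset.sum_const_nat hfib, mul_comm]
  rw [hcyc, Set.ncard_coe_finset, ← hcard, ← Set.ncard_coe_finset]
  refine Set.ncard_congr (fun w _ => (G.closedWalkEquiv d w).1) ?_ ?_ ?_
  · intro w hw
    exact ⟨Function.mk_mem_periodicPts d.succ_pos (G.closedWalkEquiv d w).2,
      (Finset.mem_filter.1 hw).2⟩
  · intro w₁ w₂ _ _ h
    exact (G.closedWalkEquiv d).injective (Subtype.ext h)
  · rintro x ⟨_, hx⟩
    have hper : Function.IsPeriodicPt G.shift (d + 1) x :=
      hx ▸ Function.isPeriodicPt_minimalPeriod _ _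
    exact ⟨(G.closedWalkEquiv d).symm ⟨x, hper⟩, by simp [hP, hx], by simp⟩

/-- Sort the points of period `d` by their minimal period, a divisor of `d`. -/
theorem sum_divisors_mul_ncard_cycles [Finite E] {d : ℕ} (hd : 0 < d) :
    ∑ e ∈ d.divisors, e * (G.cycles e).ncard = Nat.card (G.ClosedWalk d) := by
  classical
  have hfin := G.finite_isPeriodicPt hd
  have h1 : Nat.card (G.ClosedWalk d) = hfin.toFinset.card := by
    rw [← Set.ncard_eq_toFinset_card _ hfin]
    obtain ⟨d, rfl⟩ := Nat.exists_eq_succ_of_ne_zero hd.ne'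
    exact Nat.card_congr (G.closedWalkEquiv d)
  rw [h1, Finset.card_eq_sum_card_fiberwise (f := Function.minimalPeriod G.shift)
    (t := d.divisors)]
  · refine Finset.sum_congr rfl fun e he => ?_
    have hed := Nat.dvd_of_mem_divisors he
    rw [G.mul_ncard_cycles (Nat.pos_of_mem_divisors he), ← Set.ncard_coe_finset]
    congr 1
    ext x
    simp only [Set.mem_ofPred_eq, Finset.coe_filter, Set.Finite.mem_toFinset]
    refine and_congr_left fun hx => ⟨fun _ => ?_, fun h => Function.mk_mem_periodicPts hd h⟩
    exact Function.isPeriodicPt_iff_minimalPeriod_dvd.2 (hx ▸ hed)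
  · intro x hx
    simp only [Set.Finite.coe_toFinset, Set.mem_ofPred_eq] at hx
    exact Nat.mem_divisors.2 ⟨hx.minimalPeriod_dvd, hd.ne'⟩

theorem ncard_cycles_eq [Finite E] {d : ℕ} (hd : 0 < d) :
    ((G.cycles d).ncard : ℚ) = (1 / (d : ℚ)) * ∑ e ∈ d.divisors,
      ((ArithmeticFunction.moebius (d / e) : ℤ) : ℚ) * (Nat.card (G.ClosedWalk e) : ℚ) := by
  have h := (ArithmeticFunction.sum_eq_iff_sum_mul_moebius_eq
    (f := fun e : ℕ => ((e * (G.cycles e).ncard : ℕ) : ℚ))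
    (g := fun e => (Nat.card (G.ClosedWalk e) : ℚ))).1 (fun e he => by
      rw [← Nat.cast_sum, G.sum_divisors_mul_ncard_cycles he]) d hd
  have hd' : (d : ℚ) ≠ 0 := by exact_mod_cast hd.ne'
  rw [Nat.sum_divisorsAntidiagonal'
    (f := fun a b => ((ArithmeticFunction.moebius a : ℤ) : ℚ) * (Nat.card (G.ClosedWalk b) : ℚ))]
    at h
  rw [h]
  push_cast
  field_simp

end Multidigraph
end OverlapGraph

/-! ### Laminar families of arcs on a cycle -/

namespace OverlapGraph

/-- The arcs `[k - a k, k]` with `a k < n` on the cycle `ZMod d` form a laminar family; the value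
`n` stands for an unbounded arc. -/
def IsLaminar {d : ℕ} (n : ℕ) (a : ZMod d → ℕ) : Prop :=
  (∀ k, a k ≤ n) ∧ ∀ k, a k < n → ∀ t : ℕ, 1 ≤ t → t ≤ a k → t + a (k - t) ≤ a k

/-- A bounded arc going once around the cycle would have to contain a translate of itself by `d`. -/
theorem IsLaminar.lt_period {d n : ℕ} {a : ZMod d → ℕ} (ha : IsLaminar n a) (hd : 1 ≤ d)
    {k : ZMod d} (hk : a k < n) : a k < d := by
  by_contra h
  have := ha.2 k hk d hd (not_lt.1 h)
  simp at this
  omega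

theorem exists_arcLength (n : ℕ) {d : ℕ} (c : ZMod d → ℕ) (k : ZMod d) :
    ∃ a, a = n ∨ a + 1 ≤ ∑ t ∈ Finset.range (a + 1), c (k - t) :=
  ⟨n, Or.inl rfl⟩

open Classical in
/-- The length of the arc closing at `k`, when `c m` arcs open at each `m`. -/
noncomputable def arcLength (n : ℕ) {d : ℕ} (c : ZMod d → ℕ) (k : ZMod d) : ℕ :=
  Nat.find (exists_arcLength n c k)

theorem arcLength_le (n : ℕ) {d : ℕ} (c : ZMod d → ℕ) (k : ZMod d) : arcLength n c k ≤ n :=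
  Nat.find_min' _ (Or.inl rfl)

theorem arcLength_eq_iff {n d : ℕ} {c : ZMod d → ℕ} {k : ZMod d} {a : ℕ} :
    arcLength n c k = a ↔ (a = n ∨ a + 1 ≤ ∑ t ∈ Finset.range (a + 1), c (k - t)) ∧
      ∀ b < a, b ≠ n ∧ ∑ t ∈ Finset.range (b + 1), c (k - t) ≤ b := by
  rw [arcLength, Nat.find_eq_iff]
  simp only [not_or, not_le, Nat.lt_succ_iff]

theorem sum_shift_split {d : ℕ} (c : ZMod d → ℕ) (k : ZMod d) (t u : ℕ) :
    ∑ s ∈ Finset.range (t + u), c (k - s) =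
      ∑ s ∈ Finset.range t, c (k - s) + ∑ s ∈ Finset.range u, c (k - t - s) := by
  rw [Finset.sum_range_add]
  simp only [Nat.cast_add, sub_add_eq_sub_sub]

/-- By minimality, fewer than `t` arcs open at the last `t` points of the arc closing at `k`. The
rest of the arc then has enough openings to stop the search at `k - t` inside it. -/
theorem isLaminar_arcLength (n : ℕ) {d : ℕ} (c : ZMod d → ℕ) : IsLaminar n (arcLength n c) := by
  refine ⟨arcLength_le n c, fun k hk t ht hta => ?_⟩
  obtain ⟨h1, h2⟩ := arcLength_eq_iff.1 (rfl : arcLength n c k = _)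
  have h1 := h1.resolve_left hk.ne
  have h3 := (h2 (t - 1) (by omega)).2
  rw [Nat.sub_add_cancel ht] at h3
  have h4 := sum_shift_split c k t (arcLength n c k - t + 1)
  rw [show t + (arcLength n c k - t + 1) = arcLength n c k + 1 by omega] at h4
  have : arcLength n c (k - t) ≤ arcLength n c k - t := by
    refine Nat.find_min' _ (Or.inr ?_)
    omega
  omega

/-- The number of bounded arcs opening at `m`. -/
def openings {d : ℕ} [NeZero d] (n : ℕ) (a : ZMod d → ℕ) (m : ZMod d) : ℕ :=
  (Finset.univ.filter fun k => a k < n ∧ k - a k = m).card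

theorem sum_openings_le {d : ℕ} [NeZero d] (n : ℕ) (a : ZMod d → ℕ) :
    ∑ m, openings n a m ≤ d := by
  have h : ∀ m, openings n a m =
      ((Finset.univ.filter fun k => a k < n).filter fun k => k - a k = m).card := by
    intro m; rw [openings, Finset.filter_filter]
  simp only [h]
  rw [← Finset.card_eq_sum_card_fiberwise (fun _ _ => Finset.mem_univ _)]
  exact (Finset.card_le_univ _).trans (ZMod.card d).le

theorem sum_range_openings {d : ℕ} [NeZero d] (n : ℕ) (a : ZMod d → ℕ) (k : ZMod d) (m : ℕ) :
    ∑ t ∈ Finset.range m, openings n a (k - t) =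
      ((Finset.range m).sigma fun t =>
        Finset.univ.filter fun j => a j < n ∧ j - a j = k - t).card := by
  rw [Finset.card_sigma]; rfl

/-- Inside a bounded arc every point closes an arc that also opens there, so openings are at least
as many as points. In a shorter window ending at `k`, every bounded arc that opens there closes
before `k`, so openings fall short. -/
theorem arcLength_openings {d n : ℕ} [NeZero d] {a : ZMod d → ℕ} (ha : IsLaminar n a) :
    arcLength n (openings n a) = a := by
  funext k
  rw [arcLength_eq_iff]
  constructor
  · rcases (ha.1 k).eq_or_lt with h | h
    · exact Or.inl h
    refine Or.inr ?_
    rw [sum_range_openings]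
    have key : ∀ s ≤ a k, s + a (k - s) ≤ a k := by
      intro s hs
      rcases Nat.eq_zero_or_pos s with rfl | h0
      · simp
      · exact ha.2 k h s h0 hs
    conv_lhs => rw [← Finset.card_range (a k + 1)]
    refine Finset.card_le_card_of_injOn (fun s => ⟨s + a (k - s), k - s⟩) ?_ ?_
    · intro s hs
      have hs' : s ≤ a k := by simpa [Nat.lt_succ_iff] using hs
      have := key s hs'
      simp only [Finset.coe_sigma, Set.mem_sigma_iff, Finset.mem_coe, Finset.mem_range,
        Finset.mem_filter, Finset.mem_univ, true_and]
      refine ⟨by omega, by omega, ?_⟩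
      push_cast; ring
    · intro s _ s' _ h
      simp only [Sigma.mk.injEq, heq_eq_eq] at h
      obtain ⟨h1, h2⟩ := h
      rw [h2] at h1
      omega
  · intro b hb
    have hbn := hb.trans_le (ha.1 k)
    refine ⟨hbn.ne, ?_⟩
    rw [sum_range_openings]
    -- An arc opening in the window and reaching `k` would contain the arc at `k`, forcing `a k ≤ t
    -- ≤ b`.
    have key : ∀ t ≤ b, ∀ j, a j < n → j - a j = k - t → a j < t := by
      intro t ht j hj hjk
      by_contra hle
      have hle := not_lt.1 hle
      have hk : k = j - ((a j - t : ℕ) : ZMod d) := by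
        rw [Nat.cast_sub hle]; linear_combination -hjk
      rcases hle.eq_or_lt with h | h
      · rw [h, Nat.sub_self, Nat.cast_zero, sub_zero] at hk
        subst hk; omega
      · have := ha.2 j hj (a j - t) (by omega) (by omega)
        rw [← hk] at this
        omega
    have hc : (Finset.Icc 1 b).card = b := by simp
    conv_rhs => rw [← hc]
    -- Each arc is sent to the distance from its closing point back to `k`.
    refine Finset.card_le_card_of_injOn (fun x => x.1 - a x.2) ?_ ?_
    · rintro ⟨t, j⟩ h
      simp only [Finset.coe_sigma, Set.mem_sigma_iff, Finset.mem_coe, Finset.mem_range,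
        Finset.mem_filter, Finset.mem_univ, true_and] at h
      have := key t (by omega) j h.2.1 h.2.2
      simp only [Finset.coe_Icc, Set.mem_Icc]
      omega
    · rintro ⟨t, j⟩ h ⟨t', j'⟩ h' e
      simp only [Finset.coe_sigma, Set.mem_sigma_iff, Finset.mem_coe, Finset.mem_range,
        Finset.mem_filter, Finset.mem_univ, true_and] at h h' e
      have h1 := key t (by omega) j h.2.1 h.2.2
      have h2 := key t' (by omega) j' h'.2.1 h'.2.2
      have e' : ((t - a j : ℕ) : ZMod d) = ((t' - a j' : ℕ) : ZMod d) := by rw [e]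
      rw [Nat.cast_sub h1.le, Nat.cast_sub h2.le] at e'
      have hj : j = j' := by linear_combination h.2.2 - h'.2.2 - e'
      subst hj
      have : t = t' := by omega
      subst this
      rfl

/-- An integer sequence that descends by at most one per step and reaches `1` has exactly `R 0`
positive strict record lows. -/
theorem card_strict_record_lows {N : ℕ} (R : ℕ → ℤ) (hstep : ∀ s, R s - 1 ≤ R (s + 1))
    (hN : R N ≤ 1) :
    ((Finset.range (N + 1)).filter fun s => 1 ≤ R s ∧ ∀ u < s, R s < R u).card = (R 0).toNat := by
  have hc : (Finset.Icc 1 (R 0)).card = (R 0).toNat := by simp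
  rw [← hc]
  refine Finset.card_bij (fun s _ => R s) ?_ ?_ ?_
  · intro s hs
    simp only [Finset.mem_filter, Finset.mem_range, Finset.mem_Icc] at hs ⊢
    refine ⟨hs.2.1, ?_⟩
    rcases Nat.eq_zero_or_pos s with rfl | h
    · exact le_rfl
    · exact (hs.2.2 0 h).le
  · intro s hs s' hs' h
    simp only [Finset.mem_filter] at hs hs'
    rcases lt_trichotomy s s' with h' | h' | h'
    · exact absurd h (hs'.2.2 s h').ne'
    · exact h'
    · exact absurd h (hs.2.2 s' h').ne
  · intro v hv
    rw [Finset.mem_Icc] at hv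
    have hex : ∃ s, R s ≤ v := ⟨N, hN.trans hv.1⟩
    obtain ⟨s, hs, hmin⟩ : ∃ s, R s ≤ v ∧ ∀ u < s, v < R u :=
      ⟨Nat.find hex, Nat.find_spec hex, fun u hu => not_le.1 (Nat.find_min hex hu)⟩
    have hsv : R s = v := by
      rcases s with _ | s
      · omega
      · have := hstep s
        have := hmin s (Nat.lt_succ_self s)
        omega
    refine ⟨s, ?_, hsv⟩
    simp only [Finset.mem_filter, Finset.mem_range]
    refine ⟨?_, by omega, fun u hu => by have := hmin u hu; omega⟩
    by_contra hlt
    have := hmin N (by omega)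
    omega

theorem sum_range_reflect_shift {d : ℕ} (c : ZMod d → ℕ) (m : ZMod d) (s : ℕ) :
    ∑ t ∈ Finset.range (s + 1), c (m + s - t) = ∑ t ∈ Finset.range (s + 1), c (m + t) := by
  rw [← Finset.sum_range_reflect]
  refine Finset.sum_congr rfl fun t ht => ?_
  rw [Finset.mem_range] at ht
  rw [Nat.add_sub_cancel, Nat.cast_sub (by omega)]
  congr 1; ring

/-- The stopping rule, read forwards from the opening point `m`. Passing from a suffix of the window
to the complementary prefix turns "too few openings in the suffix" into "the walk was higher after
the prefix", so arcs opening at `m` are positive strict record lows. -/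
theorem arcLength_add_eq_iff {n d : ℕ} {c : ZMod d → ℕ} {m : ZMod d} {s : ℕ} (hs : s < n) :
    arcLength n c (m + s) = s ↔
      1 ≤ (∑ t ∈ Finset.range (s + 1), (c (m + t) : ℤ)) - s ∧ ∀ u < s,
        (∑ t ∈ Finset.range (s + 1), (c (m + t) : ℤ)) - s <
          (∑ t ∈ Finset.range (u + 1), (c (m + t) : ℤ)) - u := by
  rw [arcLength_eq_iff, sum_range_reflect_shift]
  have key : ∀ u < s, ∑ t ∈ Finset.range (s + 1), c (m + t) =
      ∑ t ∈ Finset.range (s - 1 - u + 1), c (m + s - t) +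
        ∑ t ∈ Finset.range (u + 1), c (m + t) := by
    intro u hu
    rw [← sum_range_reflect_shift, ← sum_range_reflect_shift c m u,
      show s + 1 = (s - 1 - u + 1) + (u + 1) by omega, sum_shift_split]
    congr 1
    refine Finset.sum_congr rfl fun t _ => ?_
    congr 2
    rw [show s - 1 - u + 1 = s - u by omega, Nat.cast_sub hu.le]
    ring
  simp only [← Nat.cast_sum]
  refine and_congr (by omega) ⟨fun h u hu => ?_, fun h b hb => ⟨by omega, ?_⟩⟩
  · have := (h (s - 1 - u) (by omega)).2
    have := key u hu
    omega
  · have h1 := h (s - 1 - b) (by omega)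
    have h2 := key (s - 1 - b) (by omega)
    rw [show s - 1 - (s - 1 - b) = b by omega] at h2
    omega

theorem sum_range_shift_eq {d : ℕ} [NeZero d] (c : ZMod d → ℕ) (m : ZMod d) :
    ∑ t ∈ Finset.range d, c (m + t) = ∑ j, c j := by
  refine Finset.sum_bij (fun t _ => m + t) (fun _ _ => Finset.mem_univ _) ?_ ?_ (fun _ _ => rfl)
  · intro t ht u hu h
    have h := add_left_cancel h
    rw [ZMod.natCast_eq_natCast_iff'] at h
    rwa [Nat.mod_eq_of_lt (Finset.mem_range.1 ht), Nat.mod_eq_of_lt (Finset.mem_range.1 hu)] at h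
  · intro j _
    refine ⟨(j - m).val, Finset.mem_range.2 (ZMod.val_lt _), ?_⟩
    rw [ZMod.natCast_zmod_val]; ring

/-- The walk of partial sums from `m`, minus the number of steps, starts at `c m`, so it has `c m`
positive record lows. They occur within one turn, at `s < d ≤ n`, so the corresponding arcs are
bounded. -/
theorem openings_arcLength {d n : ℕ} [NeZero d] (hdn : d ≤ n) {c : ZMod d → ℕ}
    (hc : ∑ m, c m ≤ d) : openings n (arcLength n c) = c := by
  funext m
  have hd : 1 ≤ d := NeZero.one_le
  have hR := card_strict_record_lows (N := d - 1)
    (fun s => (∑ t ∈ Finset.range (s + 1), (c (m + t) : ℤ)) - s)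
    (fun s => by
      simp only [Finset.sum_range_succ _ (s + 1)]
      push_cast
      have : (0 : ℤ) ≤ c (m + (s + 1)) := Int.natCast_nonneg _
      linarith)
    (by
      -- After a full turn the walk is at the total of `c` minus `d - 1`, hence at most `1`.
      rw [Nat.sub_add_cancel hd, ← Nat.cast_sum, sum_range_shift_eq]
      omega)
  simp only [zero_add, Finset.range_one, Finset.sum_singleton, Nat.cast_zero, add_zero, sub_zero,
    Int.toNat_natCast, Nat.sub_add_cancel hd] at hR
  rw [← hR, openings]
  refine Finset.card_bij' (fun k _ => arcLength n c k) (fun s _ => m + s) ?_ ?_ ?_ ?_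
  · intro k hk
    simp only [Finset.mem_filter, Finset.mem_univ, true_and] at hk
    have hlt := (isLaminar_arcLength n c).lt_period hd hk.1
    rw [Finset.mem_filter, Finset.mem_range]
    refine ⟨hlt, (arcLength_add_eq_iff hk.1).1 ?_⟩
    congr 1
    rw [← hk.2]; ring
  · intro s hs
    rw [Finset.mem_filter, Finset.mem_range] at hs
    have h := (arcLength_add_eq_iff (hs.1.trans_le hdn)).2 hs.2
    simp only [Finset.mem_filter, Finset.mem_univ, true_and, h]
    exact ⟨hs.1.trans_le hdn, by ring⟩
  · intro k hk
    simp only [Finset.mem_filter, Finset.mem_univ, true_and] at hk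
    rw [← hk.2]; ring
  · intro s hs
    rw [Finset.mem_filter, Finset.mem_range] at hs
    exact (arcLength_add_eq_iff (hs.1.trans_le hdn)).2 hs.2

/-- Laminar families of arcs on a cycle of length `d ≤ n` are determined by how many bounded arcs
open at each point. -/
noncomputable def laminarEquiv {d n : ℕ} [NeZero d] (hdn : d ≤ n) :
    {a : ZMod d → ℕ // IsLaminar n a} ≃ {c : ZMod d → ℕ // ∑ m, c m ≤ d} where
  toFun a := ⟨openings n a.1, sum_openings_le n a.1⟩
  invFun c := ⟨arcLength n c.1, isLaminar_arcLength n c.1⟩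
  left_inv a := Subtype.ext (arcLength_openings a.2)
  right_inv c := Subtype.ext (openings_arcLength hdn c.2)

theorem card_sum_le (ι : Type*) [Fintype ι] (d : ℕ) :
    Nat.card {c : ι → ℕ // ∑ m, c m ≤ d} = (Fintype.card ι + d).choose d := by
  classical
  -- The extra coordinate `none` is a slack variable.
  let f : {c : ι → ℕ // ∑ m, c m ≤ d} ≃ {P : Option ι → ℕ // ∑ i, P i = d} :=
    { toFun := fun c => ⟨fun o => o.elim (d - ∑ m, c.1 m) c.1, by
        simp [Fintype.sum_option, Nat.sub_add_cancel c.2]⟩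
      invFun := fun c => ⟨fun i => c.1 (some i), by
        have := c.2
        rw [Fintype.sum_option] at this
        exact (Nat.le_add_left _ _).trans this.le⟩
      left_inv := fun c => rfl
      right_inv := fun c => by
        have := c.2
        rw [Fintype.sum_option] at this
        refine Subtype.ext (funext fun o => ?_)
        rcases o with _ | i
        · simp only [Option.elim_none]; omega
        · rfl }
  rw [Nat.card_congr (f.trans (Sym.equivNatSumOfFintype (Option ι) d).symm),
    Nat.card_eq_fintype_card, Sym.card_sym_eq_choose, Fintype.card_option]
  congr 1
  omega

theorem card_laminar {d n : ℕ} [NeZero d] (hdn : d ≤ n) :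
    Nat.card {a : ZMod d → ℕ // IsLaminar n a} = (2 * d).choose d := by
  rw [Nat.card_congr (laminarEquiv hdn), card_sum_le, ZMod.card, two_mul]

end OverlapGraph

/-! ### From closed walks to laminar families -/

namespace OverlapGraph

theorem perm_eq_of_lt_iff {m : ℕ} {σ τ : Perm (Fin m)} (h : ∀ p q, σ p < σ q ↔ τ p < τ q) :
    σ = τ := by
  have hs : ∀ (ρ : Perm (Fin m)) (q), (Finset.univ.filter fun p => ρ p < ρ q).card = ρ q := by
    intro ρ q
    have : (Finset.univ.filter fun p => ρ p < ρ q) = (Finset.Iio (ρ q)).map ρ.symm.toEmbedding := by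
      ext p
      simp [Finset.mem_map_equiv]
    rw [this, Finset.card_map, Fin.card_Iio]
  ext q
  rw [← hs σ q, ← hs τ q]
  simp only [h]

theorem standardization_eq_iff {α β : Type*} [LinearOrder α] [LinearOrder β] {m : ℕ}
    {x : Fin m → α} {y : Fin m → β} (hx : Function.Injective x) (hy : Function.Injective y) :
    standardization x hx = standardization y hy ↔ ∀ p q, x p < x q ↔ y p < y q := by
  constructor
  · intro h p q
    rw [← standardization_lt_iff x hx, h, standardization_lt_iff]
  · intro h
    refine perm_eq_of_lt_iff fun p q => ?_
    rw [standardization_lt_iff, standardization_lt_iff, h]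

theorem standardization_eq_perm_iff {α : Type*} [LinearOrder α] {m : ℕ} {x : Fin m → α}
    (hx : Function.Injective x) (τ : Perm (Fin m)) :
    standardization x hx = τ ↔ ∀ p q, x p < x q ↔ τ p < τ q := by
  constructor
  · rintro rfl p q
    rw [standardization_lt_iff]
  · intro h
    refine perm_eq_of_lt_iff fun p q => ?_
    rw [standardization_lt_iff, h]

theorem avoids_pattern312_iff {m : ℕ} (σ : Perm (Fin m)) :
    Avoids σ pattern312 ↔ ∀ i j k, i < j → j < k → ¬ (σ j < σ k ∧ σ k < σ i) := by
  simp only [Avoids, standardization_eq_perm_iff, not_exists]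
  constructor
  · rintro h i j k hij hjk ⟨h1, h2⟩
    refine h (OrderEmbedding.ofStrictMono ![i, j, k] ?_) ?_
    · rw [Fin.strictMono_iff_lt_succ]
      intro s
      fin_cases s
      · exact hij
      · exact hjk
    · intro p q
      have h3 := h1.trans h2
      fin_cases p <;> fin_cases q <;>
        simp [pattern312, h1, h2, h3, h1.le, h2.le, h3.le]
  · intro h f hf
    refine h (f 0) (f 1) (f 2) (f.strictMono (by decide)) (f.strictMono (by decide)) ⟨?_, ?_⟩
    · exact (hf 1 2).2 (by decide)
    · exact (hf 2 0).2 (by decide)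

/-- The letter at distance `s` from the end. -/
def backLetter {n : ℕ} (σ : Perm (Fin (n + 1))) (s : ℕ) : ℕ := σ ⟨n - s, by omega⟩

theorem backLetter_rev {n : ℕ} (σ : Perm (Fin (n + 1))) (p : Fin (n + 1)) :
    backLetter σ p.rev = σ p := by
  unfold backLetter
  congr 2
  ext
  simp only [Fin.val_rev]
  omega

theorem backLetter_ne {n : ℕ} (σ : Perm (Fin (n + 1))) {s t : ℕ} (hst : s < t) (ht : t ≤ n) :
    backLetter σ s ≠ backLetter σ t := by
  intro h
  have := congrArg Fin.val (σ.injective (Fin.ext h))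
  simp only at this
  omega

theorem avoids_pattern312_iff_backLetter {n : ℕ} (σ : Perm (Fin (n + 1))) :
    Avoids σ pattern312 ↔ ∀ s t u, s < t → t < u → u ≤ n →
      backLetter σ s < backLetter σ u → backLetter σ s < backLetter σ t := by
  rw [avoids_pattern312_iff]
  constructor
  · intro h s t u hst htu hu hlt
    by_contra hle
    have := backLetter_ne σ hst (htu.le.trans hu)
    refine h ⟨n - u, by omega⟩ ⟨n - t, by omega⟩ ⟨n - s, by omega⟩ (Fin.mk_lt_mk.2 (by omega))
      (Fin.mk_lt_mk.2 (by omega)) ⟨Fin.lt_def.2 ?_, Fin.lt_def.2 hlt⟩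
    exact lt_of_le_of_ne (not_lt.1 hle) this.symm
  · rintro h i j k hij hjk ⟨h1, h2⟩
    have := h k.rev j.rev i.rev (Fin.rev_lt_rev.2 hjk) (Fin.rev_lt_rev.2 hij)
      (Nat.lt_succ_iff.1 i.rev.2)
    simp only [backLetter_rev] at this
    exact absurd (this h2) (not_lt.2 (Fin.le_def.1 h1.le))

/-- Consecutive edges overlap: the last letters of `σ` are ordered like the first ones of `τ`. -/
theorem head_eq_tail_iff {n : ℕ} (σ τ : Perm (Fin (n + 1))) :
    (overlapGraph n).head σ = (overlapGraph n).tail τ ↔ ∀ s < n, ∀ t < n,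
      (backLetter σ s < backLetter σ t ↔ backLetter τ (s + 1) < backLetter τ (t + 1)) := by
  simp only [overlapGraph, standardization_eq_iff]
  have hσ : ∀ p : Fin n, ((σ (Fin.succOrderEmb n p) : Fin (n + 1)) : ℕ) = backLetter σ p.rev := by
    intro p
    rw [← backLetter_rev]
    congr 1
    simp [Fin.val_rev]
  have hτ : ∀ p : Fin n,
      ((τ (Fin.castSuccOrderEmb p) : Fin (n + 1)) : ℕ) = backLetter τ (p.rev + 1) := by
    intro p
    rw [← backLetter_rev]
    congr 1
    simp [Fin.val_rev]
    omega
  simp only [Fin.lt_def, hσ, hτ]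
  constructor
  · intro h s hs t ht
    have := h (Fin.rev ⟨s, hs⟩) (Fin.rev ⟨t, ht⟩)
    simpa only [Fin.rev_rev] using this
  · intro h p q
    exact h _ p.rev.2 _ q.rev.2

/-- Families of edges indexed by `ZMod d` that form a closed walk. -/
def IsCyclicFamily {d n : ℕ} (e : ZMod d → Perm (Fin (n + 1))) : Prop :=
  (∀ i, Avoids (e i) pattern312) ∧
    ∀ i, (overlapGraph n).head (e i) = (overlapGraph n).tail (e (i + 1))

/-- The number of letters in the block directly before the last letter that exceed it. -/
def lastBlock {n : ℕ} (σ : Perm (Fin (n + 1))) : ℕ :=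
  Nat.findGreatest (fun t => backLetter σ 0 < backLetter σ t) n

theorem le_lastBlock_iff {n : ℕ} {σ : Perm (Fin (n + 1))} (hσ : Avoids σ pattern312) {t : ℕ}
    (ht : 1 ≤ t) (htn : t ≤ n) : t ≤ lastBlock σ ↔ backLetter σ 0 < backLetter σ t := by
  constructor
  · intro h
    have hspec : backLetter σ 0 < backLetter σ (lastBlock σ) :=
      Nat.findGreatest_of_ne_zero (P := fun t => backLetter σ 0 < backLetter σ t) rfl (by omega)
    rcases h.eq_or_lt with h | h
    · rwa [h]
    · exact (avoids_pattern312_iff_backLetter σ).1 hσ 0 t _ ht h (Nat.findGreatest_le n) hspec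
  · intro h
    exact Nat.le_findGreatest htn h

namespace IsCyclicFamily

variable {d n : ℕ} {e : ZMod d → Perm (Fin (n + 1))}

/-- Stepping back `s` edges preserves the comparison and makes the later letter the last one. -/
theorem backLetter_lt_iff (he : IsCyclicFamily e) {s t : ℕ} (hst : s < t) (ht : t ≤ n)
    (i : ZMod d) :
    backLetter (e i) s < backLetter (e i) t ↔ t - s ≤ lastBlock (e (i - s)) := by
  induction s generalizing t i with
  | zero =>
    rw [le_lastBlock_iff (he.1 _) (by omega) (by omega)]
    simp
  | succ s ih =>
    obtain ⟨t, rfl⟩ : ∃ t', t = t' + 1 := ⟨t - 1, by omega⟩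
    have h := (head_eq_tail_iff _ _).1 (he.2 (i - 1)) s (by omega) t (by omega)
    rw [sub_add_cancel] at h
    rw [← h, ih (by omega) (by omega), show i - 1 - (s : ZMod d) = i - ((s + 1 : ℕ) : ZMod d) by
      push_cast; ring, Nat.add_sub_add_right]

theorem isLaminar (he : IsCyclicFamily e) : IsLaminar n fun i => lastBlock (e i) := by
  refine ⟨fun i => Nat.findGreatest_le n, fun k hk t ht htk => ?_⟩
  by_contra hlt
  simp only [not_le] at hlt hk htk
  -- If the inner block stuck out, the letter just beyond the outer block would exceed the letter at
  -- distance `t`, hence the last letter. That letter exists because the outer block is shorter than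
  -- `n`.
  have h1 := (he.backLetter_lt_iff (s := t) (t := lastBlock (e k) + 1) (by omega) (by omega) k).2
    (by omega)
  have h2 := (le_lastBlock_iff (he.1 k) ht (by omega)).1 htk
  have h3 := (le_lastBlock_iff (he.1 k) (by omega) (by omega)).2 (h2.trans h1)
  omega

theorem eq_of_lastBlock_eq {e' : ZMod d → Perm (Fin (n + 1))} (he : IsCyclicFamily e)
    (he' : IsCyclicFamily e') (h : ∀ i, lastBlock (e i) = lastBlock (e' i)) : e = e' := by
  have key : ∀ i s t, s < t → t ≤ n →
      (backLetter (e i) s < backLetter (e i) t ↔ backLetter (e' i) s < backLetter (e' i) t) := by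
    intro i s t hst ht
    rw [he.backLetter_lt_iff hst ht, he'.backLetter_lt_iff hst ht, h]
  funext i
  refine perm_eq_of_lt_iff fun p q => ?_
  simp only [Fin.lt_def, ← backLetter_rev]
  have hp := Nat.lt_succ_iff.1 p.rev.2
  have hq := Nat.lt_succ_iff.1 q.rev.2
  rcases lt_trichotomy (p.rev : ℕ) q.rev with h | h | h
  · exact key i _ _ h hq
  · rw [h]; simp only [lt_irrefl]
  · have h1 := key i _ _ h hp
    have h2 := backLetter_ne (e i) h hp
    have h3 := backLetter_ne (e' i) h hp
    omega

end IsCyclicFamily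

/-! ### From laminar families to closed walks -/

/-- The order of the letters at distances `s` and `t` before position `i` that is prescribed by
the block lengths `a`. -/
def blockLT {d : ℕ} (a : ZMod d → ℕ) (i : ZMod d) (s t : ℕ) : Prop :=
  (s < t ∧ t - s ≤ a (i - s)) ∨ (t < s ∧ ¬ s - t ≤ a (i - t))

theorem blockLT_trans {d n : ℕ} {a : ZMod d → ℕ} (ha : IsLaminar n a) {i : ZMod d} {s t u : ℕ}
    (hs : s ≤ n) (ht : t ≤ n) (hu : u ≤ n) (hst : blockLT a i s t) (htu : blockLT a i t u) :
    blockLT a i s u := by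
  -- Nesting gives this for a bounded arc; an arc of length `n` covers the whole window anyway. The
  -- mixed cases follow by contradiction.
  have key : ∀ p q r : ℕ, p < q → q < r → r ≤ n → q - p ≤ a (i - p) → r - q ≤ a (i - q) →
      r - p ≤ a (i - p) := by
    intro p q r hpq hqr hr h1 h2
    rcases (ha.1 (i - p)).eq_or_lt with h | h
    · omega
    · have := ha.2 _ h (q - p) (by omega) h1
      rw [Nat.cast_sub hpq.le, show i - (p : ZMod d) - (q - p) = i - q by ring] at this
      omega
  rcases hst with ⟨h1, h2⟩ | ⟨h1, h2⟩ <;> rcases htu with ⟨h3, h4⟩ | ⟨h3, h4⟩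
  · exact Or.inl ⟨h1.trans h3, key s t u h1 h3 hu h2 h4⟩
  · rcases lt_trichotomy s u with h | rfl | h
    · exact Or.inl ⟨h, by omega⟩
    · exact absurd h2 h4
    · exact Or.inr ⟨h, fun h5 => h4 (key u s t h h1 ht h5 h2)⟩
  · have h : u < s := by omega
    exact Or.inr ⟨h, fun h5 => h2 (key t u s h3 h hs h4 h5)⟩
  · exact Or.inr ⟨h3.trans h1, by omega⟩

theorem exists_perm_of_isLaminar {d n : ℕ} {a : ZMod d → ℕ} (ha : IsLaminar n a) (i : ZMod d) :
    ∃ σ : Perm (Fin (n + 1)), ∀ s ≤ n, ∀ t ≤ n,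
      (backLetter σ s < backLetter σ t ↔ blockLT a i s t) := by
  classical
  let r : Fin (n + 1) → Fin (n + 1) → Prop := fun p q => blockLT a i p.rev q.rev
  have hirr : ∀ p, ¬ r p p := fun p => by simp [r, blockLT]
  have htr : ∀ p q u, r p q → r q u → r p u := fun p q u =>
    blockLT_trans ha (Nat.lt_succ_iff.1 p.rev.2) (Nat.lt_succ_iff.1 q.rev.2)
      (Nat.lt_succ_iff.1 u.rev.2)
  have htri : ∀ p q, ¬ r p q → ¬ r q p → p = q := by
    intro p q h1 h2
    rw [← Fin.rev_inj]
    simp only [r, blockLT] at h1 h2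
    ext
    omega
  have : IsStrictTotalOrder (Fin (n + 1)) r :=
    { trichotomous := htri, irrefl := hirr, trans := htr }
  -- The positions themselves, ordered by `r`, serve as the word to standardize.
  refine ⟨@standardization (Fin (n + 1)) (linearOrderOfSTO r) (n + 1) id Function.injective_id,
    fun s hs t ht => ?_⟩
  have h := @standardization_lt_iff (Fin (n + 1)) (linearOrderOfSTO r) (n + 1) id
    Function.injective_id ⟨n - s, by omega⟩ ⟨n - t, by omega⟩
  rw [Fin.lt_def] at h
  refine h.trans ?_
  change blockLT a i _ _ ↔ _
  simp only [Fin.val_rev, id]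
  rw [show n + 1 - (n - s + 1) = s by omega, show n + 1 - (n - t + 1) = t by omega]

theorem exists_isCyclicFamily {d n : ℕ} {a : ZMod d → ℕ} (ha : IsLaminar n a) :
    ∃ e : ZMod d → Perm (Fin (n + 1)), IsCyclicFamily e ∧ ∀ i, lastBlock (e i) = a i := by
  choose e he using exists_perm_of_isLaminar ha
  refine ⟨e, ⟨fun i => ?_, fun i => ?_⟩, fun i => ?_⟩
  · rw [avoids_pattern312_iff_backLetter]
    intro s t u hst htu hu
    rw [he i s (by omega) u hu, he i s (by omega) t (by omega)]
    unfold blockLT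
    omega
  · rw [head_eq_tail_iff]
    intro s hs t ht
    rw [he i s hs.le t ht.le, he (i + 1) (s + 1) hs (t + 1) ht]
    unfold blockLT
    have h : ∀ v : ℕ, i + 1 - ((v + 1 : ℕ) : ZMod d) = i - v := fun v => by push_cast; ring
    simp only [h, Nat.add_sub_add_right, Nat.add_lt_add_iff_right]
  · have h : ∀ t ≤ n, (backLetter (e i) 0 < backLetter (e i) t ↔ 0 < t ∧ t ≤ a i) := by
      intro t ht
      rw [he i 0 (Nat.zero_le n) t ht]
      simp [blockLT]
    rw [lastBlock, Nat.findGreatest_eq_iff]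
    refine ⟨ha.1 i, fun h0 => (h _ (ha.1 i)).2 (by omega), fun t h1 h2 h3 => ?_⟩
    have := (h t h2).1 h3
    omega

theorem card_cyclicFamily {d : ℕ} (n : ℕ) :
    Nat.card {e : ZMod d → Perm (Fin (n + 1)) // IsCyclicFamily e} =
      Nat.card {a : ZMod d → ℕ // IsLaminar n a} := by
  refine Nat.card_eq_of_bijective (fun e => ⟨fun i => lastBlock (e.1 i), e.2.isLaminar⟩) ⟨?_, ?_⟩
  · intro e e' h
    exact Subtype.ext (e.2.eq_of_lastBlock_eq e'.2 fun i => congrFun (congrArg Subtype.val h) i)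
  · rintro ⟨a, ha⟩
    obtain ⟨e, he, h⟩ := exists_isCyclicFamily ha
    exact ⟨⟨e, he⟩, Subtype.ext (funext h)⟩

/-- Closed walks as families of edges indexed by `ZMod (d + 1)`. -/
def closedWalkEquivCyclicFamily (d n : ℕ) :
    (avoidingOverlapGraph n pattern312).ClosedWalk (d + 1) ≃
      {e : ZMod (d + 1) → Perm (Fin (n + 1)) // IsCyclicFamily e} where
  toFun w := ⟨fun i => (w.1 i).1, fun i => (w.1 i).2, fun i => by
    have h : (finRotate (d + 1) i : ZMod (d + 1)) = i + (1 : ZMod (d + 1)) :=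
      finRotate_apply (n := d + 1) i
    exact h ▸ congrArg Subtype.val (w.2 i)⟩
  invFun e := ⟨fun i => ⟨e.1 i, e.2.1 i⟩, fun i => by
    rw [finRotate_apply]
    exact Subtype.ext (e.2.2 i)⟩
  left_inv _ := rfl
  right_inv _ := rfl

theorem card_closedWalk {d n : ℕ} (hd : 1 ≤ d) (hdn : d ≤ n) :
    Nat.card ((avoidingOverlapGraph n pattern312).ClosedWalk d) = (2 * d).choose d := by
  obtain ⟨d, rfl⟩ := Nat.exists_eq_add_of_le' hd
  rw [Nat.card_congr (closedWalkEquivCyclicFamily d n), card_cyclicFamily, card_laminar hdn]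

end OverlapGraph

theorem theorem5p2 (n d : ℕ) (hd : 1 ≤ d) (hdn : d ≤ n) :
    ((((OverlapGraph.avoidingOverlapGraph n OverlapGraph.pattern312).cycles d).ncard : ℕ) : ℚ) =
      (1 / (d : ℚ)) * ∑ e ∈ d.divisors,
        ((ArithmeticFunction.moebius (d / e) : ℤ) : ℚ) * ((Nat.choose (2 * e) e : ℕ) : ℚ) := by
  rw [OverlapGraph.Multidigraph.ncard_cycles_eq _ hd]
  congr 1
  refine Finset.sum_congr rfl fun e he => ?_
  rw [OverlapGraph.card_closedWalk (Nat.pos_of_mem_divisors he)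
    ((Nat.divisor_le he).trans hdn)]
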